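/- Let $R$ be an associative ring with identity, let $t\ge 1$ be an integer and let $\sigma:R\to R$ be a ring endomorphism with $\sigma^{t}=1$ (the identity map). Let $R[w,\sigma]$ be the skew polynomial ring, whose elements are the left polynomials $r_0+r_1w+\cdots+r_kw^k$ with $r_i\in R$, multiplied according to the rule $wr=\sigma(r)w$ for $r\in R$, and let $(w^t)$ be the two-sided ideal of $R[w,\sigma]$ generated by $w^t$. For an integer $m\ge 1$ let $$S_m(x_1,\ldots,x_m)=\sum_{\pi\in\mathrm{Sym}(m)}\mathrm{sgn}(\pi)\,x_{\pi(1)}\cdots x_{\pi(m)}$$ be the standard polynomial in the noncommuting indeterminates $x_1,\ldots,x_m$; a ring $A$ is said to satisfy $S_m=0$ if $S_m(a_1,\ldots,a_m)=0$ for all $a_1,\ldots,a_m\in A$. If $S_m=0$ is an identity on $R$ and $n\ge 1$ is an integer, then $S_{(m-1)t^2n^2+1}=0$ is an identity on the full matrix ring $\mathrm{M}_n(R[w,\sigma]/(w^t))$. In particular, $S_{(m-1)t^2+1}=0$ is an identity on $R[w,\sigma]/(w^t)$. -/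

import Mathlib

/-- The standard polynomial `S_m = ∑_π sgn(π) x_{π(1)} ⋯ x_{π(m)}` (the sum runs over all
permutations of the `m` indices), in the free associative ring on `m` noncommuting
indeterminates. -/
noncomputable def standardPolynomial (m : ℕ) : FreeAlgebra ℤ (Fin m) :=
  ∑ π : Equiv.Perm (Fin m),
    (Equiv.Perm.sign π : ℤ) • (List.ofFn fun i : Fin m => FreeAlgebra.ι ℤ (π i)).prod

/-- `S_m = 0` is an identity on the ring `A`: every substitution of elements of `A` for the
indeterminates sends `S_m` to `0`. -/
def SatisfiesStandardIdentity (m : ℕ) (A : Type*) [Ring A] : Prop :=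
  ∀ x : Fin m → A, FreeAlgebra.lift ℤ x (standardPolynomial m) = 0

theorem lift_standardPolynomial {A : Type*} [Ring A] {m : ℕ} (x : Fin m → A) :
    FreeAlgebra.lift ℤ x (standardPolynomial m) =
      ∑ π : Equiv.Perm (Fin m),
        (Equiv.Perm.sign π : ℤ) • (List.ofFn fun i : Fin m => x (π i)).prod := by
  simp [standardPolynomial, map_sum, map_list_prod, List.map_ofFn, Function.comp_def]

/-- The action of the additive monoid of natural numbers on `R` in which `j` acts as `σ ^ j`. -/
@[reducible] def endoAction {R : Type*} [Ring R] (σ : R →+* R) :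
    MulSemiringAction (Multiplicative ℕ) R :=
  MulSemiringAction.compHom R (powersHom (R →+* R) σ)

/-- The skew polynomial ring `R[w, σ]`: left polynomials `∑ r_i w ^ i` with the multiplication
determined by `w r = σ(r) w`. -/
def SkewPoly {R : Type*} [Ring R] (_σ : R →+* R) : Type _ := SkewPolynomial R

namespace SkewPoly

variable {R : Type*} [Ring R] (σ : R →+* R)

noncomputable instance : Ring (SkewPoly σ) :=
  letI := endoAction σ
  inferInstanceAs (Ring (SkewPolynomial R))

/-- The left monomial `r w ^ i` of `R[w, σ]`. -/
noncomputable def monomial (i : ℕ) (r : R) : SkewPoly σ :=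
  (SkewPolynomial.monomial i r : SkewPolynomial R)

/-- The skew indeterminate `w` of `R[w, σ]`. -/
noncomputable def w : SkewPoly σ := monomial σ 1 1

theorem monomial_mul_monomial (i j : ℕ) (r s : R) :
    monomial σ i r * monomial σ j s = monomial σ (i + j) (r * (σ ^ i) s) := by
  letI := endoAction σ
  exact SkewMonoidAlgebra.single_mul_single

theorem w_mul (r : R) : w σ * monomial σ 0 r = monomial σ 0 (σ r) * w σ := by
  simp [w, monomial_mul_monomial]

end SkewPoly

/-- The truncated skew polynomial ring `R[w, σ] / (w ^ t)`, the quotient by the two-sided ideal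
generated by `w ^ t`. -/
abbrev TruncatedSkewPoly {R : Type*} [Ring R] (σ : R →+* R) (t : ℕ) : Type _ :=
  (TwoSidedIdeal.span {SkewPoly.w σ ^ t}).ringCon.Quotient

/-!
The ring `R[w, σ] / (w ^ t)` is a free right `R`-module with basis `1, w, …, w ^ (t - 1)`, because
`σ` is invertible. Left multiplication embeds it into the `t × t` matrices over `R`
(`TruncatedSkewPoly.exists_injective_ringHom`). Both claims thus follow from
`SatisfiesStandardIdentity.matrix`: if `S_m = 0` holds on `R`, then `S_N = 0` holds on the `n × n`
matrices over `R` for `N = (m - 1) n² + 1`.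

This is proved with Grassmann variables. Let `A = R ⊗ Λ(ℤ ^ N)`, and call an element of `A` odd if
it is an `R`-combination of the variables `θ_i` times central elements. The identity `S_m = 0` on
`R` says that odd elements, also those of `A[t]`, have vanishing `m`-th power
(`SatisfiesStandardIdentity.sum_mul_pow_eq_zero`). Hence, for odd `x` and `w`, the inverse
`∑ t ^ k b (x b) ^ k` of `1 - (t x + w)`, where `b = (1 - w)⁻¹`, has degree less than `m` in `t`, so
`b (x b) ^ m = 0`. Any `y ∈ A` with constant term `1` is of the form `u (1 - w)⁻¹` with `u` even and
invertible and `w` odd. As `x u` is odd too, this gives `(x y) ^ (m - 1) x = 0`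
(`IsGrassmannFamily.mul_pow_mul_eq_zero`).

Now let `a_1, …, a_N` be matrices over `R`. By multilinearity each may be taken to be an element of
`R` times one of the `n²` rank one idempotents that form a basis of the integer matrices. As
`N > (m - 1) n²`, some idempotent `e` is used `d ≥ m` times. Write `∑ a_i θ_i = x e + W`, where `x` is
odd and `W` collects the terms with the other idempotents. The coefficient of `t ^ d` in the inverse
of `1 - (t x e + W)` is `B (x e B) ^ d` with `B = (1 - W)⁻¹`. Compressing `B` to `e` gives an
element `y` of `A` with constant term `1`, so this coefficient vanishes by the previous paragraph
(`IsGrassmannFamily.geom_sum_mul_idempotentEntry_pow_eq_zero`). On the other hand its component at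
`θ_1 ⋯ θ_N` is `S_N(a_1, …, a_N)`.
-/

/-! ### The standard polynomial as an alternating multilinear map -/

theorem lift_standardPolynomial_eq_alternatization {A : Type*} [Ring A] {m : ℕ} (x : Fin m → A) :
    FreeAlgebra.lift ℤ x (standardPolynomial m) =
      MultilinearMap.alternatization (MultilinearMap.mkPiAlgebraFin ℤ m A) x := by
  rw [lift_standardPolynomial, MultilinearMap.alternatization_apply]
  simp [Units.smul_def]

/-- A standard identity is inherited by every ring that embeds into one satisfying it. -/
theorem SatisfiesStandardIdentity.of_injective {A B : Type*} [Ring A] [Ring B] {m : ℕ}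
    (hB : SatisfiesStandardIdentity m B) (φ : A →+* B) (hφ : Function.Injective φ) :
    SatisfiesStandardIdentity m A := by
  intro x
  apply hφ
  have h := hB (φ ∘ x)
  rw [lift_standardPolynomial] at h ⊢
  simpa [map_sum, map_list_prod, List.map_ofFn, Function.comp_def] using h

/-! ### Anticommuting elements -/

/-- A finite family of anticommuting elements of square zero is the image of the standard
generators of an exterior algebra. -/
theorem exists_exteriorAlgebra_hom {B ι : Type*} [Ring B] [Fintype ι] [DecidableEq ι] (g : ι → B)
    (hanti : ∀ i j, g i * g j = -(g j * g i)) (hsq : ∀ i, g i * g i = 0) :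
    ∃ Φ : ExteriorAlgebra ℤ (ι → ℤ) →ₐ[ℤ] B,
      ∀ i, Φ (ExteriorAlgebra.ι ℤ (Pi.single i 1)) = g i := by
  have key : ∀ v : ι → ℤ,
      Fintype.linearCombination ℤ g v * Fintype.linearCombination ℤ g v = 0 := by
    intro v
    simp only [Fintype.linearCombination_apply]
    have : ∀ s : Finset ι, (∑ i ∈ s, v i • g i) * (∑ i ∈ s, v i • g i) = 0 := by
      intro s
      induction s using Finset.induction_on with
      | empty => simp
      | insert a s ha ih =>
        have h2 : (v a • g a) * (∑ i ∈ s, v i • g i) = -((∑ i ∈ s, v i • g i) * (v a • g a)) := by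
          rw [Finset.mul_sum, Finset.sum_mul, ← Finset.sum_neg_distrib]
          refine Finset.sum_congr rfl fun i _ => ?_
          rw [smul_mul_smul_comm, smul_mul_smul_comm, hanti a i, smul_neg, mul_comm]
        rw [Finset.sum_insert ha, add_mul, mul_add, mul_add, ih, h2, smul_mul_smul_comm, hsq]
        simp
    exact this _
  refine ⟨ExteriorAlgebra.lift ℤ ⟨Fintype.linearCombination ℤ g, key⟩, fun i => ?_⟩
  rw [ExteriorAlgebra.lift_ι_apply]
  simp

theorem prod_ofFn_comp_eq_zero_of_not_injective {B ι : Type*} [Ring B] [Fintype ι] (g : ι → B)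
    (hanti : ∀ i j, g i * g j = -(g j * g i)) (hsq : ∀ i, g i * g i = 0) {k : ℕ} (f : Fin k → ι)
    (hf : ¬ Function.Injective f) : (List.ofFn fun i => g (f i)).prod = 0 := by
  classical
  obtain ⟨Φ, hΦ⟩ := exists_exteriorAlgebra_hom g hanti hsq
  obtain ⟨i, j, hij, hne⟩ : ∃ i j, f i = f j ∧ i ≠ j := by
    simpa [Function.Injective] using hf
  have h : (List.ofFn fun i => g (f i)).prod =
      Φ (ExteriorAlgebra.ιMulti ℤ k fun i => Pi.single (f i) 1) := by
    simp [ExteriorAlgebra.ιMulti_apply, map_list_prod, List.map_ofFn, Function.comp_def, hΦ]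
  rw [h, AlternatingMap.map_eq_zero_of_eq _ _ (by simp [hij]) hne, map_zero]

theorem prod_ofFn_perm {B : Type*} [Ring B] {k : ℕ} (g : Fin k → B)
    (hanti : ∀ i j, g i * g j = -(g j * g i)) (hsq : ∀ i, g i * g i = 0)
    (π : Equiv.Perm (Fin k)) :
    (List.ofFn fun i => g (π i)).prod = (Equiv.Perm.sign π : ℤ) • (List.ofFn g).prod := by
  obtain ⟨Φ, hΦ⟩ := exists_exteriorAlgebra_hom g hanti hsq
  have h : ∀ f : Fin k → Fin k, (List.ofFn fun i => g (f i)).prod =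
      Φ (ExteriorAlgebra.ιMulti ℤ k ((fun i => Pi.single i 1) ∘ f)) := by
    intro f
    simp [ExteriorAlgebra.ιMulti_apply, map_list_prod, List.map_ofFn, Function.comp_def, hΦ]
  rw [h π, AlternatingMap.map_perm, Units.smul_def, map_zsmul]
  have := h id
  simp only [id, Function.comp_id] at this
  rw [this]

theorem prod_ofFn_mul_of_commute {R B : Type*} [Ring R] [Ring B] (ρ : R →+* B) :
    ∀ {k : ℕ} (a : Fin k → R) (g : Fin k → B) (_ : ∀ r i, Commute (ρ r) (g i)),
      (List.ofFn fun i => ρ (a i) * g i).prod = ρ (List.ofFn a).prod * (List.ofFn g).prod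
  | 0, _, _, _ => by simp
  | k + 1, a, g, h => by
    rw [List.ofFn_succ, List.ofFn_succ, List.ofFn_succ, List.prod_cons, List.prod_cons,
      List.prod_cons, prod_ofFn_mul_of_commute ρ _ _ fun r i => h r i.succ, map_mul, mul_assoc,
      mul_assoc, ← mul_assoc (g 0), ← (h _ 0).eq, mul_assoc]

theorem sum_mul_pow_eq {R B ι : Type*} [Ring R] [Ring B] [Fintype ι] (ρ : R →+* B) (a : ι → R)
    (g : ι → B) (h : ∀ r i, Commute (ρ r) (g i)) (k : ℕ) :
    (∑ i, ρ (a i) * g i) ^ k =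
      ∑ f : Fin k → ι, ρ (List.ofFn fun i => a (f i)).prod * (List.ofFn fun i => g (f i)).prod := by
  have := (MultilinearMap.mkPiAlgebraFin ℤ k B).map_sum fun _ i => ρ (a i) * g i
  simp only [MultilinearMap.mkPiAlgebraFin_apply, List.ofFn_const, List.prod_replicate] at this
  rw [this]
  exact Finset.sum_congr rfl fun f _ => prod_ofFn_mul_of_commute ρ _ _ fun r i => h r (f i)

/-- The Grassmann form of a standard identity: if `S_m = 0` holds on `R`, then a combination of
anticommuting square-zero elements with coefficients from `R` has vanishing `m`-th power. The
monomials of the `m`-th power that use a given set of `m` generators add up to a value of `S_m`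
times the product of these generators. -/
theorem SatisfiesStandardIdentity.sum_mul_pow_eq_zero {R B ι : Type*} [Ring R] [Ring B]
    [Fintype ι] {m : ℕ} (hR : SatisfiesStandardIdentity m R) (ρ : R →+* B) (a : ι → R)
    (g : ι → B) (h : ∀ r i, Commute (ρ r) (g i))
    (hanti : ∀ i j, g i * g j = -(g j * g i)) (hsq : ∀ i, g i * g i = 0) :
    (∑ i, ρ (a i) * g i) ^ m = 0 := by
  classical
  rw [sum_mul_pow_eq ρ a g h]
  set F : (Fin m → ι) → B := fun f =>
    ρ (List.ofFn fun i => a (f i)).prod * (List.ofFn fun i => g (f i)).prod with hF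
  have hF0 : ∀ f, ¬ Function.Injective f → F f = 0 := fun f hf => by
    simp only [hF]
    rw [prod_ofFn_comp_eq_zero_of_not_injective g hanti hsq f hf, mul_zero]
  -- Group the monomials according to the set of generators that occur.
  rw [← Finset.sum_fiberwise Finset.univ (fun f : Fin m → ι => Finset.univ.image f) F]
  refine Finset.sum_eq_zero fun s _ => ?_
  by_cases hs : ∃ f₀ : Fin m → ι, Function.Injective f₀ ∧ Finset.univ.image f₀ = s
  · obtain ⟨f₀, hinj, rfl⟩ := hs
    have hsum : ∑ π : Equiv.Perm (Fin m), F (f₀ ∘ π) = 0 := by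
      have hterm : ∀ π : Equiv.Perm (Fin m), F (f₀ ∘ π) =
          ρ ((Equiv.Perm.sign π : ℤ) • (List.ofFn fun i => a (f₀ (π i))).prod) *
            (List.ofFn fun i => g (f₀ i)).prod := by
        intro π
        have := prod_ofFn_perm (fun i => g (f₀ i)) (fun i j => hanti _ _) (fun i => hsq _) π
        simp only [hF, Function.comp_apply]
        rw [this, map_zsmul, smul_mul_assoc, mul_smul_comm]
      simp_rw [hterm]
      rw [← Finset.sum_mul, ← map_sum, ← lift_standardPolynomial (fun i => a (f₀ i)), hR]
      simp
    rw [← hsum]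
    symm
    refine Finset.sum_of_injOn (fun π : Equiv.Perm (Fin m) => f₀ ∘ π) ?_ ?_ ?_ fun _ _ => rfl
    · intro π _ π' _ hππ
      ext i
      exact congrArg _ (hinj (congrFun hππ i))
    · intro π _
      simp only [Finset.coe_filter, Finset.mem_univ, true_and, Set.mem_ofPred_eq]
      rw [← Finset.image_image, Finset.image_univ_equiv]
    · intro f hf hnot
      refine hF0 f fun hfi => hnot ?_
      simp only [Finset.mem_filter, Finset.mem_univ, true_and] at hf
      have hex : ∀ i, ∃ j, f₀ j = f i := fun i => by
        have : f i ∈ Finset.univ.image f₀ := hf ▸ Finset.mem_image_of_mem _ (Finset.mem_univ i)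
        simpa using this
      choose p hp using hex
      have hpi : Function.Injective p := fun i j hij => hfi (by rw [← hp i, ← hp j, hij])
      exact ⟨Equiv.ofBijective p (Finite.injective_iff_bijective.1 hpi), by simp,
        funext fun i => hp i⟩
  · refine Finset.sum_eq_zero fun f hf => hF0 f fun hfi => hs ⟨f, hfi, ?_⟩
    simpa using hf

/-! ### Nilpotent elements and geometric series -/

theorem IsNilpotent.add_central_mul {B : Type*} [Ring B] {a h : B} (ha : IsNilpotent a)
    (hc : ∀ b, Commute h b) (hh : h * h = 0) (b : B) : IsNilpotent (a + h * b) := by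
  obtain ⟨n, hn⟩ := ha
  have hex : ∀ k : ℕ, ∃ q, (a + h * b) ^ k = a ^ k + h * q := by
    intro k
    induction k with
    | zero => exact ⟨0, by simp⟩
    | succ k ih =>
      obtain ⟨q, hq⟩ := ih
      refine ⟨a ^ k * b + q * a + q * (h * b), ?_⟩
      have := ((hc (a ^ k)).eq)
      rw [_root_.pow_succ, hq, _root_.pow_succ]
      simp only [mul_add, add_mul, ← mul_assoc, this]
      abel
  obtain ⟨q, hq⟩ := hex n
  refine ⟨n * 2, ?_⟩
  rw [pow_mul, hq, hn, zero_add, sq, mul_assoc, ← mul_assoc q, ← (hc q).eq, ← mul_assoc,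
    ← mul_assoc, hh, zero_mul, zero_mul]

/-- The coefficients of `(1 - (Xτ + W))⁻¹`, for nilpotent `Xτ + W`. -/
theorem coeff_geom_sum_linear {B : Type*} [Ring B] (τ W : B) (N : ℕ) (hW : W ^ N = 0)
    (hX : (Polynomial.C τ * Polynomial.X + Polynomial.C W) ^ N = 0) (k : ℕ) :
    (∑ j ∈ Finset.range N, (Polynomial.C τ * Polynomial.X + Polynomial.C W) ^ j).coeff k =
      (∑ j ∈ Finset.range N, W ^ j) * (τ * ∑ j ∈ Finset.range N, W ^ j) ^ k := by
  set P := ∑ j ∈ Finset.range N, (Polynomial.C τ * Polynomial.X + Polynomial.C W) ^ j with hP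
  set b := ∑ j ∈ Finset.range N, W ^ j with hb
  have hb1 : (1 - W) * b = 1 := by rw [hb, mul_neg_geom_sum, hW, sub_zero]
  have hP1 : P * (1 - (Polynomial.C τ * Polynomial.X + Polynomial.C W)) = 1 := by
    rw [hP, geom_sum_mul_neg, hX, sub_zero]
  have hP2 : P - P * Polynomial.C τ * Polynomial.X - P * Polynomial.C W = 1 := by
    rw [← hP1]; noncomm_ring
  have cancel : ∀ c d : B, c - c * W = d → c = d * b := by
    intro c d h
    rw [← h, ← mul_one_sub, mul_assoc, hb1, mul_one]
  induction k with
  | zero =>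
    have := congrArg (fun p => Polynomial.coeff p 0) hP2
    simp only [Polynomial.coeff_sub, Polynomial.mul_coeff_zero, Polynomial.coeff_X_zero, mul_zero,
      sub_zero, Polynomial.coeff_C_zero, Polynomial.coeff_one_zero] at this
    simpa using cancel _ _ this
  | succ k ih =>
    have := congrArg (fun p => Polynomial.coeff p (k + 1)) hP2
    simp only [Polynomial.coeff_sub, Polynomial.coeff_mul_X, Polynomial.coeff_mul_C,
      Polynomial.coeff_one, Nat.succ_ne_zero, if_false] at this
    rw [cancel (P.coeff (k + 1)) (P.coeff k * τ) (by
      rw [sub_right_comm, sub_eq_zero] at this; exact this), ih, pow_succ]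
    simp only [mul_assoc]

/-! ### Odd elements of a Grassmann extension -/

/-- `θ` is a family of Grassmann variables over the image of `ρ`: they commute with the
coefficients, anticommute with each other, have square zero, and their pairwise products are
scalars from the commutative ring `K`. -/
structure IsGrassmannFamily (K : Type*) {R A ι : Type*} [CommRing K] [Ring R] [Ring A]
    [Algebra K A] (ρ : R →+* A) (θ : ι → A) : Prop where
  commute : ∀ r i, Commute (ρ r) (θ i)
  anticomm : ∀ i j, θ i * θ j = -(θ j * θ i)
  sq : ∀ i, θ i * θ i = 0
  mul_mem : ∀ i j, ∃ c : K, θ i * θ j = algebraMap K A c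

/-- The odd elements: combinations of the Grassmann variables with coefficients from `R`. -/
def grassmannOdd (K : Type*) {R A ι : Type*} [CommRing K] [Ring R] [Ring A]
    [Algebra K A] (ρ : R →+* A) (θ : ι → A) : Submodule K A :=
  Submodule.span K {x | ∃ r i, x = ρ r * θ i}

/-- The even elements without constant term: combinations of the products of two Grassmann
variables with coefficients from `R`. -/
def grassmannEven (K : Type*) {R A ι : Type*} [CommRing K] [Ring R] [Ring A]
    [Algebra K A] (ρ : R →+* A) (θ : ι → A) : Submodule K A :=
  Submodule.span K {x | ∃ r i j, x = ρ r * (θ i * θ j)}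

namespace IsGrassmannFamily

variable {K R A ι : Type*} [CommRing K] [Ring R] [Ring A] [Algebra K A] {ρ : R →+* A} {θ : ι → A}

theorem odd_mul_odd (h : IsGrassmannFamily K ρ θ) {x y : A} (hx : x ∈ grassmannOdd K ρ θ)
    (hy : y ∈ grassmannOdd K ρ θ) : x * y ∈ grassmannEven K ρ θ := by
  have := Submodule.mul_mem_mul hx hy
  rw [grassmannOdd, Submodule.span_mul_span] at this
  refine Submodule.span_le.2 ?_ this
  rintro _ ⟨_, ⟨r, i, rfl⟩, _, ⟨s, j, rfl⟩, rfl⟩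
  refine Submodule.subset_span ⟨r * s, i, j, ?_⟩
  change ρ r * θ i * (ρ s * θ j) = _
  rw [map_mul, mul_assoc, ← mul_assoc (θ i), ← (h.commute s i).eq]
  simp only [mul_assoc]

theorem odd_mul_even (h : IsGrassmannFamily K ρ θ) {x y : A} (hx : x ∈ grassmannOdd K ρ θ)
    (hy : y ∈ grassmannEven K ρ θ) : x * y ∈ grassmannOdd K ρ θ := by
  have := Submodule.mul_mem_mul hx hy
  rw [grassmannOdd, grassmannEven, Submodule.span_mul_span] at this
  refine Submodule.span_le.2 ?_ this
  rintro _ ⟨_, ⟨r, i, rfl⟩, _, ⟨s, j, k, rfl⟩, rfl⟩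
  obtain ⟨c, hc⟩ := h.mul_mem j k
  have : ρ r * θ i * (ρ s * (θ j * θ k)) = c • (ρ (r * s) * θ i) := by
    rw [hc, ← Algebra.commutes, Algebra.smul_def, ← mul_assoc, ← Algebra.commutes, map_mul]
    simp only [mul_assoc, (h.commute s i).eq]
  change ρ r * θ i * (ρ s * (θ j * θ k)) ∈ _
  rw [this]
  exact Submodule.smul_mem _ _ (Submodule.subset_span ⟨_, i, rfl⟩)

theorem even_mul_odd (h : IsGrassmannFamily K ρ θ) {x y : A} (hx : x ∈ grassmannEven K ρ θ)
    (hy : y ∈ grassmannOdd K ρ θ) : x * y ∈ grassmannOdd K ρ θ := by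
  have := Submodule.mul_mem_mul hx hy
  rw [grassmannOdd, grassmannEven, Submodule.span_mul_span] at this
  refine Submodule.span_le.2 ?_ this
  rintro _ ⟨_, ⟨s, j, k, rfl⟩, _, ⟨r, i, rfl⟩, rfl⟩
  obtain ⟨c, hc⟩ := h.mul_mem j k
  have : ρ s * (θ j * θ k) * (ρ r * θ i) = c • (ρ (s * r) * θ i) := by
    rw [hc, ← Algebra.commutes, Algebra.smul_def, map_mul]
    simp only [mul_assoc]
  change ρ s * (θ j * θ k) * (ρ r * θ i) ∈ _
  rw [this]
  exact Submodule.smul_mem _ _ (Submodule.subset_span ⟨_, i, rfl⟩)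

theorem even_mul_even (h : IsGrassmannFamily K ρ θ) {x y : A} (hx : x ∈ grassmannEven K ρ θ)
    (hy : y ∈ grassmannEven K ρ θ) : x * y ∈ grassmannEven K ρ θ := by
  have := Submodule.mul_mem_mul hx hy
  rw [grassmannEven, Submodule.span_mul_span] at this
  refine Submodule.span_le.2 ?_ this
  rintro _ ⟨_, ⟨s, j, k, rfl⟩, _, ⟨r, i, l, rfl⟩, rfl⟩
  obtain ⟨c, hc⟩ := h.mul_mem j k
  have : ρ s * (θ j * θ k) * (ρ r * (θ i * θ l)) = c • (ρ (s * r) * (θ i * θ l)) := by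
    rw [hc, ← Algebra.commutes, Algebra.smul_def, map_mul]
    simp only [mul_assoc]
  change ρ s * (θ j * θ k) * (ρ r * (θ i * θ l)) ∈ _
  rw [this]
  exact Submodule.smul_mem _ _ (Submodule.subset_span ⟨_, i, l, rfl⟩)

theorem isNilpotent_of_mem_even (h : IsGrassmannFamily K ρ θ) {x : A}
    (hx : x ∈ grassmannEven K ρ θ) : IsNilpotent x := by
  suffices H : ∀ (k : K) (a : A), IsNilpotent a → IsNilpotent (a + k • x) by
    simpa using H 1 0 IsNilpotent.zero
  induction hx using Submodule.span_induction with
  | zero => intro k a ha; simpa using ha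
  | add x y _ _ hx hy =>
    intro k a ha
    rw [smul_add, ← add_assoc]
    exact hy k _ (hx k a ha)
  | smul c x _ hx =>
    intro k a ha
    rw [smul_smul]
    exact hx _ a ha
  | mem x hx =>
    obtain ⟨r, i, j, rfl⟩ := hx
    intro k a ha
    obtain ⟨c, hc⟩ := h.mul_mem i j
    have hsq : algebraMap K A c * algebraMap K A c = 0 := by
      rw [← hc, mul_assoc, ← mul_assoc (θ j), h.anticomm j i, neg_mul, mul_neg, mul_assoc,
        h.sq, mul_zero, mul_zero, neg_zero]
    have : k • (ρ r * (θ i * θ j)) = algebraMap K A c * (k • ρ r) := by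
      rw [hc, ← Algebra.commutes, mul_smul_comm]
    rw [this]
    exact ha.add_central_mul (fun b => Algebra.commutes c b) hsq _

/-- An odd element is a finite sum of terms `ρ r * g`, with `g` a scalar multiple of a Grassmann
variable. -/
theorem exists_sum_of_mem_odd {x : A} (hx : x ∈ grassmannOdd K ρ θ) :
    ∃ (n : ℕ) (r : Fin n → R) (c : Fin n → K) (p : Fin n → ι),
      x = ∑ i, ρ (r i) * c i • θ (p i) := by
  obtain ⟨n, c, s, hs⟩ := Submodule.mem_span_set'.1 hx
  choose r p hrp using fun i => (s i).2
  refine ⟨n, r, c, p, ?_⟩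
  rw [← hs]
  exact Finset.sum_congr rfl fun i _ => by rw [hrp, mul_smul_comm]

/-- For odd `x` and `w`, the element `1 - (tx + w)` of `A[t]` has an inverse of degree less than
`m`, because `tx + w` is again odd. The coefficient of `t ^ m` in this inverse is the element
below. -/
theorem geom_mul_pow_eq_zero (h : IsGrassmannFamily K ρ θ) {m : ℕ}
    (hR : SatisfiesStandardIdentity m R) {x w : A} (hx : x ∈ grassmannOdd K ρ θ)
    (hw : w ∈ grassmannOdd K ρ θ) :
    w ^ m = 0 ∧
      (∑ j ∈ Finset.range m, w ^ j) * (x * ∑ j ∈ Finset.range m, w ^ j) ^ m = 0 := by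
  obtain ⟨n, r, c, p, hxs⟩ := exists_sum_of_mem_odd hx
  obtain ⟨n', r', c', p', hws⟩ := exists_sum_of_mem_odd hw
  have hX : (Polynomial.C x * Polynomial.X + Polynomial.C w) ^ m = 0 := by
    have := hR.sum_mul_pow_eq_zero (Polynomial.C.comp ρ) (Sum.elim r r')
      (fun i => Polynomial.monomial (Sum.elim (fun _ => 1) (fun _ => 0) i)
        (Sum.elim c c' i • θ (Sum.elim p p' i))) ?_ ?_ ?_
    · rw [← this, hxs, hws, Polynomial.C_mul_X_eq_monomial]
      simp [Fintype.sum_sum_type, map_sum, Polynomial.C_mul_monomial, ← Polynomial.smul_C]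
    · intro r i
      change Polynomial.C (ρ r) * _ = _ * Polynomial.C (ρ r)
      rw [Polynomial.C_mul_monomial, Polynomial.monomial_mul_C,
        ((h.commute r _).smul_right _).eq]
    · intro i j
      rw [Polynomial.monomial_mul_monomial, Polynomial.monomial_mul_monomial, smul_mul_smul_comm,
        smul_mul_smul_comm, h.anticomm, mul_comm, smul_neg, map_neg, add_comm]
    · intro i
      rw [Polynomial.monomial_mul_monomial, smul_mul_smul_comm, h.sq, smul_zero, map_zero]
  have hw0 : w ^ m = 0 := by
    have h0 := congrArg Polynomial.constantCoeff hX
    simpa [map_pow] using h0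
  refine ⟨hw0, ?_⟩
  rw [← coeff_geom_sum_linear x w m hw0 hX m, Polynomial.finsetSum_coeff]
  refine Finset.sum_eq_zero fun j hj => Polynomial.coeff_eq_zero_of_natDegree_lt ?_
  have h1 : (Polynomial.C x * Polynomial.X + Polynomial.C w).natDegree ≤ 1 :=
    Polynomial.natDegree_linear_le
  have h2 := Polynomial.natDegree_pow_le_of_le j h1
  rw [Finset.mem_range] at hj
  omega

/-- The substitution `x ↦ xu`, with `u` even, turns the vanishing of `(x (1 - w)⁻¹) ^ m` into that
of `(xy) ^ m` for `y = u (1 - w)⁻¹`. Every element `y` with constant term `1` has this form. -/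
theorem mul_pow_mul_eq_zero (h : IsGrassmannFamily K ρ θ) {m : ℕ} (hm : 1 ≤ m)
    (hR : SatisfiesStandardIdentity m R) {x y : A} (hx : x ∈ grassmannOdd K ρ θ)
    (hy : y - 1 ∈ grassmannEven K ρ θ ⊔ grassmannOdd K ρ θ) :
    (x * y) ^ (m - 1) * x = 0 := by
  obtain ⟨e, he, o, ho, heo⟩ := Submodule.mem_sup.1 hy
  have hye : y = 1 + e + o := by rw [add_assoc, heo]; abel
  -- `v` is the inverse of the even part `1 + e` of `y`
  obtain ⟨v, hve, hev, hv⟩ : ∃ v, v * (1 + e) = 1 ∧ (1 + e) * v = 1 ∧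
      v - 1 ∈ grassmannEven K ρ θ := by
    obtain ⟨n, hn⟩ := (h.isNilpotent_of_mem_even he).neg
    refine ⟨∑ j ∈ Finset.range (n + 1), (-e) ^ j, ?_, ?_, ?_⟩
    · have := geom_sum_mul_neg (-e) (n + 1)
      rwa [pow_succ, hn, zero_mul, sub_zero, sub_neg_eq_add] at this
    · have := mul_neg_geom_sum (-e) (n + 1)
      rwa [pow_succ, hn, zero_mul, sub_zero, sub_neg_eq_add] at this
    · rw [Finset.sum_range_succ', pow_zero, add_sub_cancel_right]
      refine Submodule.sum_mem _ fun j hj => ?_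
      clear hj
      induction j with
      | zero => simpa using he
      | succ j ih => rw [pow_succ]; exact h.even_mul_even ih (Submodule.neg_mem _ he)
  set w := v * o with hw
  have hwo : w ∈ grassmannOdd K ρ θ := by
    have : w = (v - 1) * o + o := by rw [hw]; noncomm_ring
    rw [this]
    exact Submodule.add_mem _ (h.even_mul_odd hv ho) ho
  have hyw : y = (1 + e) * (1 + w) := by
    rw [hw, mul_add, ← mul_assoc, hev, hye]; simp
  set u := (1 + e) * ((1 + w) * (1 - w)) with hu
  have hxu : x * u ∈ grassmannOdd K ρ θ := by
    have h1 : x * (1 + e) ∈ grassmannOdd K ρ θ := by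
      rw [mul_add, mul_one]
      exact Submodule.add_mem _ hx (h.odd_mul_even hx he)
    have : x * u = x * (1 + e) - x * (1 + e) * (w * w) := by rw [hu]; noncomm_ring
    rw [this]
    exact Submodule.sub_mem _ h1 (h.odd_mul_even h1 (h.odd_mul_odd hwo hwo))
  obtain ⟨hwm, hb⟩ := h.geom_mul_pow_eq_zero hR hxu hwo
  set b := ∑ j ∈ Finset.range m, w ^ j with hbdef
  have hb1 : (1 - w) * b = 1 := by rw [hbdef, mul_neg_geom_sum, hwm, sub_zero]
  have hxy : x * u * b = x * y := by
    rw [hu, hyw, mul_assoc, mul_assoc (1 + e), mul_assoc (1 + w), hb1, mul_one]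
  rw [hxy] at hb
  have hpow : (x * y) ^ m = 0 := by
    have := congrArg ((1 - w) * ·) hb
    simpa [← mul_assoc, hb1] using this
  -- `y` is invertible, so its last occurrence can be cancelled
  obtain ⟨z, hz⟩ : ∃ z, y * z = 1 := by
    have hwm' : (-w) ^ m = 0 := by rw [neg_pow, hwm, mul_zero]
    refine ⟨(∑ j ∈ Finset.range m, (-w) ^ j) * v, ?_⟩
    have := mul_neg_geom_sum (-w) m
    rw [hwm', sub_zero, sub_neg_eq_add] at this
    rw [hyw, mul_assoc, ← mul_assoc (1 + w), this, one_mul, hev]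
  have := congrArg (· * z) hpow
  obtain ⟨k, rfl⟩ := Nat.exists_eq_add_of_le' hm
  simpa [pow_succ, mul_assoc, hz] using this

end IsGrassmannFamily

/-! ### Matrices with odd entries -/

/-- The product of the entry `x` with the rank one idempotent integer matrix `e_i (e_i + e_j)ᵀ`, or
`e_i e_iᵀ` if `i = j`. These idempotents form a `ℤ`-basis of the integer matrices. Unlike for
matrix units, the element `y` with `τ(x) M τ(x') = τ(x y x')` always involves a diagonal entry of
`M`. For `M = (1 - W)⁻¹` with odd `W` this makes the constant term of `y` equal to `1`. -/
def idempotentEntry {n A : Type*} [DecidableEq n] [Ring A] (i j : n) (x : A) : Matrix n n A :=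
  Matrix.single i i x + if i = j then 0 else Matrix.single i j x

section idempotentEntry

variable {n A : Type*} [DecidableEq n] [Ring A]

theorem idempotentEntry_zero (i j : n) : idempotentEntry i j (0 : A) = 0 := by
  simp [idempotentEntry]

theorem idempotentEntry_apply (i j : n) (x : A) (k l : n) :
    idempotentEntry i j x k l = if i = k ∧ (k = l ∨ j = l) then x else 0 := by
  unfold idempotentEntry
  by_cases hij : i = j
  · subst hij
    by_cases h1 : i = k
    · subst h1; simp [Matrix.single_apply]
    · simp [h1]
  · by_cases h1 : i = k
    · subst h1
      by_cases h2 : i = l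
      · subst h2; simp [hij, Ne.symm hij]
      · simp [Matrix.single_apply, hij, h2]
    · simp [hij, h1]

theorem idempotentEntry_sum {ι : Type*} (i j : n) (s : Finset ι) (x : ι → A) :
    idempotentEntry i j (∑ k ∈ s, x k) = ∑ k ∈ s, idempotentEntry i j (x k) := by
  ext k l
  rw [Matrix.sum_apply]
  simp only [idempotentEntry_apply]
  split_ifs <;> simp

theorem idempotentEntry_mul_mul [Fintype n] (i j : n) (x x' : A) (M : Matrix n n A) :
    idempotentEntry i j x * M * idempotentEntry i j x' =
      idempotentEntry i j (x * (M i i + if i = j then 0 else M j i) * x') := by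
  unfold idempotentEntry
  by_cases hij : i = j
  · simp [hij, Matrix.single_mul_mul_single]
  · simp only [hij, if_false, add_mul, mul_add, Matrix.single_mul_mul_single, Matrix.single_add]

theorem exists_eq_sum_idempotentEntry [Fintype n] (M : Matrix n n A) :
    ∃ z : n × n → A, M = ∑ p, idempotentEntry p.1 p.2 (z p) := by
  refine ⟨fun p => if p.1 = p.2 then M p.1 p.1 - ∑ j ∈ Finset.univ.erase p.1, M p.1 j
    else M p.1 p.2, ?_⟩
  ext k l
  rw [Matrix.sum_apply, Fintype.sum_prod_type, Finset.sum_eq_single k]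
  · simp only [idempotentEntry_apply, true_and]
    by_cases hkl : k = l
    · subst hkl
      rw [← Finset.add_sum_erase _ _ (Finset.mem_univ k)]
      simp only [true_or, if_true]
      rw [Finset.sum_congr rfl fun j hj => if_neg (Finset.ne_of_mem_erase hj).symm]
      simp
    · simp [hkl]
  · intro i _ hi
    simp [idempotentEntry_apply, hi]
  · simp

end idempotentEntry

namespace IsGrassmannFamily

variable {K R A ι n : Type*} [CommRing K] [Ring R] [Ring A] [Algebra K A] {ρ : R →+* A}
  {θ : ι → A} [Fintype n] [DecidableEq n]

theorem pow_succ_apply_mem (h : IsGrassmannFamily K ρ θ) {W : Matrix n n A}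
    (hW : ∀ i j, W i j ∈ grassmannOdd K ρ θ) (N : ℕ) (i j : n) :
    (W ^ (N + 1)) i j ∈ grassmannEven K ρ θ ⊔ grassmannOdd K ρ θ := by
  induction N generalizing i with
  | zero => simpa using Submodule.mem_sup_right (hW i j)
  | succ N ih =>
    rw [pow_succ', Matrix.mul_apply]
    refine Submodule.sum_mem _ fun k _ => ?_
    obtain ⟨e, he, o, ho, heo⟩ := Submodule.mem_sup.1 (ih k)
    rw [← heo, mul_add]
    exact Submodule.add_mem _ (Submodule.mem_sup_right (h.odd_mul_even (hW i k) he))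
      (Submodule.mem_sup_left (h.odd_mul_odd (hW i k) ho))

/-- Compression of `(1 - W)⁻¹` to a rank one idempotent gives an element with constant term `1`. -/
theorem geom_sum_mul_idempotentEntry_pow_eq_zero (h : IsGrassmannFamily K ρ θ) {m : ℕ}
    (hm : 1 ≤ m) (hR : SatisfiesStandardIdentity m R) {x : A} (hx : x ∈ grassmannOdd K ρ θ)
    {W : Matrix n n A} (hW : ∀ i j, W i j ∈ grassmannOdd K ρ θ) (i j : n) (N : ℕ) {d : ℕ}
    (hd : m ≤ d) :
    (idempotentEntry i j x * ∑ k ∈ Finset.range (N + 1), W ^ k) ^ d = 0 := by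
  set b := ∑ k ∈ Finset.range (N + 1), W ^ k with hb
  have hb1 : ∀ k l, (b - 1) k l ∈ grassmannEven K ρ θ ⊔ grassmannOdd K ρ θ := by
    intro k l
    rw [hb, Finset.sum_range_succ', pow_zero, add_sub_cancel_right, Matrix.sum_apply]
    exact Submodule.sum_mem _ fun c _ => h.pow_succ_apply_mem hW c k l
  set y := b i i + if i = j then 0 else b j i with hy
  have hymem : y - 1 ∈ grassmannEven K ρ θ ⊔ grassmannOdd K ρ θ := by
    have h1 := hb1 i i
    have h2 := hb1 j i
    by_cases hij : i = j
    · simpa [hy, hij] using h2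
    · have := Submodule.add_mem _ h1 h2
      simp only [Matrix.sub_apply, Matrix.one_apply_eq, Matrix.one_apply_ne (Ne.symm hij),
        sub_zero] at this
      simpa [hy, hij, add_sub_right_comm] using this
  have key : ∀ k : ℕ, (idempotentEntry i j x * b) ^ k * idempotentEntry i j x =
      idempotentEntry i j ((x * y) ^ k * x) := by
    intro k
    induction k with
    | zero => simp
    | succ k ih =>
      rw [pow_succ', mul_assoc, ih, idempotentEntry_mul_mul, ← hy, pow_succ', mul_assoc (x * y)]
  obtain ⟨k, rfl⟩ := Nat.exists_eq_add_of_le' hm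
  have h0 : (idempotentEntry i j x * b) ^ (k + 1) = 0 := by
    rw [pow_succ, ← mul_assoc, key]
    have := h.mul_pow_mul_eq_zero hm hR hx hymem
    rw [Nat.add_sub_cancel] at this
    rw [this, idempotentEntry_zero, zero_mul]
  exact pow_eq_zero_of_le hd h0

end IsGrassmannFamily

theorem sum_fun_eq_sum_perm {B : Type*} [AddCommMonoid B] {N : ℕ} (F : (Fin N → Fin N) → B)
    (hF : ∀ f, ¬ Function.Injective f → F f = 0) : ∑ f, F f = ∑ π : Equiv.Perm (Fin N), F π := by
  symm
  refine Finset.sum_of_injOn (fun π : Equiv.Perm (Fin N) => (π : Fin N → Fin N)) ?_ ?_ ?_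
    fun _ _ => rfl
  · exact fun _ _ _ _ hππ => DFunLike.coe_injective hππ
  · exact fun _ _ => Finset.mem_coe.2 (Finset.mem_univ _)
  · intro f _ hnot
    exact hF f fun hfi =>
      hnot ⟨Equiv.ofBijective f (Finite.injective_iff_bijective.1 hfi), by simp, rfl⟩

theorem prod_ofFn_monomial {B : Type*} [Ring B] : ∀ {k : ℕ} (e : Fin k → ℕ) (g : Fin k → B),
    (List.ofFn fun i => Polynomial.monomial (e i) (g i)).prod =
      Polynomial.monomial (∑ i, e i) (List.ofFn g).prod
  | 0, _, _ => by simp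
  | k + 1, e, g => by
    rw [List.ofFn_succ, List.ofFn_succ, List.prod_cons, List.prod_cons, prod_ofFn_monomial,
      Polynomial.monomial_mul_monomial, Fin.sum_univ_succ]

section

variable {K R A n : Type*} [CommRing K] [Ring R] [Ring A] [Algebra K A] {ρ : R →+* A} {N : ℕ}
  {θ : Fin N → A} [Fintype n] [DecidableEq n]

/-- `S_N` vanishes at multiples of the rank one idempotents if one of the idempotents, `p`, is used
`d ≥ m` times. With `∑ a_i θ_i = τ + W`, where `τ` collects the terms with the idempotent `p`, the
coefficient of `t ^ d` in `(1 - (tτ + W))⁻¹` vanishes. The top-degree part of this coefficient is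
`S_N(a)` times the product of all Grassmann variables. The map `Λ` extracts it. -/
theorem IsGrassmannFamily.standard_idempotentEntry_eq_zero (h : IsGrassmannFamily K ρ θ)
    (Λ : A →+ R)
    (hΛ : ∀ k ≠ N, ∀ (f : Fin k → Fin N) (r : R),
      Λ (ρ r * (List.ofFn fun i => θ (f i)).prod) = 0)
    (hΛtop : ∀ r, Λ (ρ r * (List.ofFn θ).prod) = r)
    {m : ℕ} (hm : 1 ≤ m) (hR : SatisfiesStandardIdentity m R) (q : Fin N → n × n) (r : Fin N → R)
    (p : n × n) (hp : m ≤ (Finset.univ.filter fun i => q i = p).card) :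
    ∑ π : Equiv.Perm (Fin N), (Equiv.Perm.sign π : ℤ) • (List.ofFn fun i : Fin N =>
      idempotentEntry (q (π i)).1 (q (π i)).2 (r (π i))).prod = 0 := by
  set a : Fin N → Matrix n n R := fun i => idempotentEntry (q i).1 (q i).2 (r i) with ha
  set d := (Finset.univ.filter fun i => q i = p).card with hd
  let ρM : Matrix n n R →+* Matrix n n A := ρ.mapMatrix
  let θM : Fin N → Matrix n n A := fun i => Matrix.scalar n (θ i)
  let e : Fin N → ℕ := fun i => if q i = p then 1 else 0
  let Y : Fin N → Matrix n n A := fun i => ρM (a i) * θM i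
  have hYapp : ∀ i, Y i = idempotentEntry (q i).1 (q i).2 (ρ (r i) * θ i) := by
    intro i
    ext k l
    simp only [Y, ρM, θM, ha, Matrix.scalar_apply, Matrix.mul_diagonal, RingHom.mapMatrix_apply,
      Matrix.map_apply, idempotentEntry_apply]
    split_ifs <;> simp
  have hcomm : ∀ M i, Commute (ρM M) (θM i) := by
    intro M i
    ext k l
    simpa [ρM, θM, Matrix.mul_diagonal, Matrix.diagonal_mul] using (h.commute (M k l) i).eq
  set x : A := ∑ i with q i = p, ρ (r i) * θ i with hx
  have hodd : ∀ i, ρ (r i) * θ i ∈ grassmannOdd K ρ θ := fun i =>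
    Submodule.subset_span ⟨_, i, rfl⟩
  set τ : Matrix n n A := idempotentEntry p.1 p.2 x with hτ
  set W : Matrix n n A := ∑ i with ¬ q i = p, Y i with hW
  have hτY : τ = ∑ i with q i = p, Y i := by
    rw [hτ, hx, idempotentEntry_sum]
    refine Finset.sum_congr rfl fun i hi => ?_
    rw [hYapp, (Finset.mem_filter.1 hi).2]
  have hXt : Polynomial.C τ * Polynomial.X + Polynomial.C W =
      ∑ i, (Polynomial.C.comp ρM) (a i) * Polynomial.monomial (e i) (θM i) := by
    rw [Polynomial.C_mul_X_eq_monomial, ← Finset.sum_filter_add_sum_filter_not Finset.univ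
      (fun i => q i = p), hτY, hW, map_sum, map_sum]
    congr 1
    · refine Finset.sum_congr rfl fun i hi => ?_
      simp [e, (Finset.mem_filter.1 hi).2, Polynomial.C_mul_monomial, Y]
    · refine Finset.sum_congr rfl fun i hi => ?_
      simp [e, (Finset.mem_filter.1 hi).2, Y]
  have hpow : ∀ j, (Polynomial.C τ * Polynomial.X + Polynomial.C W) ^ j =
      ∑ f : Fin j → Fin N, Polynomial.monomial (∑ i, e (f i))
        (ρM (List.ofFn fun i => a (f i)).prod *
          Matrix.scalar n (List.ofFn fun i => θ (f i)).prod) := by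
    intro j
    rw [hXt, sum_mul_pow_eq]
    · refine Finset.sum_congr rfl fun f _ => ?_
      rw [prod_ofFn_monomial, RingHom.comp_apply, Polynomial.C_mul_monomial, map_list_prod
        (Matrix.scalar n), List.map_ofFn]
      rfl
    · intro M i
      change Polynomial.C (ρM M) * _ = _ * Polynomial.C (ρM M)
      rw [Polynomial.C_mul_monomial, Polynomial.monomial_mul_C, (hcomm M i).eq]
  have hninj : ∀ {j : ℕ} (f : Fin j → Fin N), ¬ Function.Injective f →
      (List.ofFn fun i => θ (f i)).prod = 0 := fun f hf =>
    prod_ofFn_comp_eq_zero_of_not_injective θ h.anticomm h.sq f hf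
  have hX0 : (Polynomial.C τ * Polynomial.X + Polynomial.C W) ^ (N + 1) = 0 := by
    rw [hpow]
    refine Finset.sum_eq_zero fun f _ => ?_
    rw [hninj f fun hf => by simpa using Fintype.card_le_of_injective f hf]
    simp
  have hW0 : W ^ (N + 1) = 0 := by
    have h0 := congrArg Polynomial.constantCoeff hX0
    simpa [map_pow] using h0
  have hgeom := coeff_geom_sum_linear τ W (N + 1) hW0 hX0 d
  have hWodd : ∀ i j, W i j ∈ grassmannOdd K ρ θ := by
    intro k l
    rw [hW, Matrix.sum_apply]
    refine Submodule.sum_mem _ fun i _ => ?_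
    rw [hYapp, idempotentEntry_apply]
    split_ifs
    exacts [hodd i, Submodule.zero_mem _]
  rw [h.geom_sum_mul_idempotentEntry_pow_eq_zero hm hR (Submodule.sum_mem _ fun i _ => hodd i)
    hWodd _ _ N hp, mul_zero, Polynomial.finsetSum_coeff] at hgeom
  have hent : ∀ (M : Matrix n n R) (c : A) (k l : n),
      (ρM M * Matrix.scalar n c) k l = ρ (M k l) * c := by
    intro M c k l
    simp [ρM, Matrix.mul_diagonal]
  ext k l
  have hsum := congrArg (fun M : Matrix n n A => Λ (M k l)) hgeom
  simp only [Matrix.sum_apply, map_sum, Matrix.zero_apply, map_zero] at hsum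
  rw [Finset.sum_eq_single N] at hsum
  · rw [Matrix.zero_apply, ← hsum, hpow, sum_fun_eq_sum_perm, Polynomial.finsetSum_coeff,
      Matrix.sum_apply, Matrix.sum_apply, map_sum]
    · refine Finset.sum_congr rfl fun π _ => ?_
      have hdeg : ∑ i, e (π i) = d := by
        rw [Equiv.sum_comp π e, hd, Finset.card_filter]
      rw [hdeg, Polynomial.coeff_monomial_same, hent, prod_ofFn_perm θ h.anticomm h.sq,
        mul_smul_comm, map_zsmul, hΛtop, Matrix.smul_apply]
    · intro f hf
      rw [hninj f hf]
      simp
  · intro j _ hj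
    rw [hpow, Polynomial.finsetSum_coeff, Matrix.sum_apply, map_sum]
    refine Finset.sum_eq_zero fun f _ => ?_
    rw [Polynomial.coeff_monomial]
    split_ifs
    · rw [hent, hΛ j hj]
    · simp
  · intro hN
    simp at hN

end

/-! ### The Grassmann extension of a ring -/

open TensorProduct in
/-- The Grassmann variables of `R ⊗ Λ(ℤ ^ N)`, with the map `Λ` to `R` that extracts the coefficient
of the product of all the variables. -/
theorem exists_isGrassmannFamily.{u} (R : Type u) [Ring R] (N : ℕ) :
    ∃ (A : Type u) (_ : Ring A) (ρ : R →+* A) (θ : Fin N → A) (Λ : A →+ R),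
      IsGrassmannFamily (Subring.center A) ρ θ ∧
      (∀ k ≠ N, ∀ (f : Fin k → Fin N) (r : R),
        Λ (ρ r * (List.ofFn fun i => θ (f i)).prod) = 0) ∧
      ∀ r, Λ (ρ r * (List.ofFn θ).prod) = r := by
  let v : Fin N → ExteriorAlgebra ℤ (Fin N → ℤ) := fun i => ExteriorAlgebra.ι ℤ (Pi.single i 1)
  let ℓ : ExteriorAlgebra ℤ (Fin N → ℤ) →ₗ[ℤ] ℤ := ExteriorAlgebra.liftAlternating fun k =>
    if h : k = N then h ▸ Matrix.detRowAlternating else 0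
  let Λ : R ⊗[ℤ] ExteriorAlgebra ℤ (Fin N → ℤ) →ₗ[ℤ] R := (TensorProduct.rid ℤ R).toLinearMap ∘ₗ ℓ.lTensor R
  have hΛ : ∀ (r : R) (w : ExteriorAlgebra ℤ (Fin N → ℤ)), Λ (r ⊗ₜ[ℤ] w) = ℓ w • r := fun r w => by
    change TensorProduct.rid ℤ R (LinearMap.lTensor R ℓ (r ⊗ₜ[ℤ] w)) = _
    rw [LinearMap.lTensor_tmul, TensorProduct.rid_tmul]
  have hv : ∀ {k : ℕ} (f : Fin k → Fin N), (List.ofFn fun i => v (f i)).prod =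
      ExteriorAlgebra.ιMulti ℤ k fun i => Pi.single (f i) 1 := fun f => by
    rw [ExteriorAlgebra.ιMulti_apply]
  have hprod : ∀ {k : ℕ} (f : Fin k → Fin N) (r : R),
      (Algebra.TensorProduct.includeLeftRingHom r : R ⊗[ℤ] ExteriorAlgebra ℤ (Fin N → ℤ)) *
        (List.ofFn fun i => (1 : R) ⊗ₜ[ℤ] v (f i)).prod =
      r ⊗ₜ[ℤ] (List.ofFn fun i => v (f i)).prod := by
    intro k f r
    have : (List.ofFn fun i => (1 : R) ⊗ₜ[ℤ] v (f i)).prod =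
        Algebra.TensorProduct.includeRight (R := ℤ) (A := R) (List.ofFn fun i => v (f i)).prod := by
      rw [map_list_prod, List.map_ofFn]; rfl
    rw [this]
    simp
  have hanti : ∀ a b : Fin N → ℤ, ExteriorAlgebra.ι ℤ a * ExteriorAlgebra.ι ℤ b =
      -(ExteriorAlgebra.ι ℤ b * ExteriorAlgebra.ι ℤ a) := fun a b =>
    eq_neg_of_add_eq_zero_left (ExteriorAlgebra.ι_add_mul_swap a b)
  have hcentral : ∀ i j (w : ExteriorAlgebra ℤ (Fin N → ℤ)), Commute (v i * v j) w := by
    intro i j w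
    induction w using ExteriorAlgebra.induction with
    | algebraMap z => exact (Algebra.commutes z _).symm
    | ι x =>
      change _ * _ = _ * _
      rw [mul_assoc, hanti _ x, mul_neg, ← mul_assoc, hanti _ x, neg_mul, neg_neg, mul_assoc]
    | mul a b ha hb => exact ha.mul_right hb
    | add a b ha hb => exact ha.add_right hb
  refine ⟨R ⊗[ℤ] ExteriorAlgebra ℤ (Fin N → ℤ), inferInstance, Algebra.TensorProduct.includeLeftRingHom,
    fun i => 1 ⊗ₜ v i, Λ.toAddMonoidHom, ⟨?_, ?_, ?_, ?_⟩, ?_, ?_⟩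
  · intro r i
    simp [Commute, SemiconjBy]
  · intro i j
    rw [Algebra.TensorProduct.tmul_mul_tmul, Algebra.TensorProduct.tmul_mul_tmul, hanti,
      TensorProduct.tmul_neg]
  · intro i
    rw [Algebra.TensorProduct.tmul_mul_tmul, ExteriorAlgebra.ι_sq_zero, TensorProduct.tmul_zero]
  · intro i j
    refine ⟨⟨(1 : R) ⊗ₜ[ℤ] (v i * v j), Subring.mem_center_iff.2 fun z => ?_⟩, ?_⟩
    · induction z using TensorProduct.induction_on with
      | zero => simp
      | tmul a w =>
        rw [Algebra.TensorProduct.tmul_mul_tmul, Algebra.TensorProduct.tmul_mul_tmul,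
          (hcentral i j w).eq, one_mul, mul_one]
      | add a b ha hb => rw [add_mul, mul_add, ha, hb]
    · rw [Algebra.TensorProduct.tmul_mul_tmul, one_mul]; rfl
  · intro k hk f r
    rw [hprod, hv]
    refine (hΛ _ _).trans ?_
    rw [ExteriorAlgebra.liftAlternating_apply_ιMulti, dif_neg hk, AlternatingMap.zero_apply,
      zero_smul]
  · intro r
    have := hprod id r
    simp only [id] at this
    have hv' := hv (id : Fin N → Fin N)
    simp only [id] at hv'
    rw [this, hv']
    have hdet : (Matrix.detRowAlternating fun i : Fin N => Pi.single i (1 : ℤ)) = 1 := by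
      have : (fun i : Fin N => Pi.single i (1 : ℤ)) = (1 : Matrix (Fin N) (Fin N) ℤ) := by
        ext i j
        simp [Matrix.one_apply, Pi.single_apply, eq_comm]
      rw [this]
      exact Matrix.det_one
    refine (hΛ _ _).trans ?_
    rw [ExteriorAlgebra.liftAlternating_apply_ιMulti, dif_pos rfl, hdet, one_smul]

/-! ### Standard identities of matrix rings -/

/-- As `S_N` is multilinear, it suffices to check a standard identity on elements of the form
`T i z`, if these generate `B` additively. -/
theorem satisfiesStandardIdentity_of_sum {B ι : Type*} [Ring B] [Fintype ι] {N : ℕ}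
    (u : ι → Type*) (T : ∀ i, u i → B) (hT : ∀ b : B, ∃ z : ∀ i, u i, b = ∑ i, T i (z i))
    (h : ∀ (q : Fin N → ι) (r : ∀ k, u (q k)), ∑ π : Equiv.Perm (Fin N),
      (Equiv.Perm.sign π : ℤ) • (List.ofFn fun k => T (q (π k)) (r (π k))).prod = 0) :
    SatisfiesStandardIdentity N B := by
  intro x
  choose z hz using fun k => hT (x k)
  rw [lift_standardPolynomial_eq_alternatization]
  have hx : x = fun k => ∑ i, T i (z k i) := funext hz
  rw [hx]
  change (MultilinearMap.alternatization (MultilinearMap.mkPiAlgebraFin ℤ N B)).toMultilinearMap _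
    = 0
  rw [MultilinearMap.map_sum]
  refine Finset.sum_eq_zero fun q _ => ?_
  change MultilinearMap.alternatization (MultilinearMap.mkPiAlgebraFin ℤ N B) _ = 0
  rw [← lift_standardPolynomial_eq_alternatization, lift_standardPolynomial]
  exact h q fun k => z k (q k)

/-- If `S_m = 0` holds on `R`, then `S_N = 0` holds on the `n × n` matrices over `R` for
`N = (m - 1) n² + 1`: by multilinearity the arguments may be taken to be multiples of the `n²` rank
one idempotents, and then one of the idempotents occurs at least `m` times. -/
theorem SatisfiesStandardIdentity.matrix {R n : Type*} [Ring R] [Fintype n] [DecidableEq n] {m : ℕ}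
    (hm : 1 ≤ m) (hR : SatisfiesStandardIdentity m R) :
    SatisfiesStandardIdentity ((m - 1) * Fintype.card n ^ 2 + 1) (Matrix n n R) := by
  refine satisfiesStandardIdentity_of_sum (fun _ : n × n => R)
    (fun p x => idempotentEntry p.1 p.2 x) exists_eq_sum_idempotentEntry fun q r => ?_
  obtain ⟨A, _, ρ, θ, Λ, h, hΛ, hΛtop⟩ :=
    exists_isGrassmannFamily R ((m - 1) * Fintype.card n ^ 2 + 1)
  obtain ⟨p, hp⟩ := Fintype.exists_lt_card_fiber_of_mul_lt_card q (n := m - 1) (by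
    rw [Fintype.card_prod, Fintype.card_fin, ← sq, mul_comm]
    exact Nat.lt_succ_self _)
  exact h.standard_idempotentEntry_eq_zero Λ hΛ hΛtop hm hR q r p (by omega)

/-! ### The truncated skew polynomial ring as a ring of matrices -/

namespace SkewPoly

variable {R : Type*} [Ring R] (σ : R →+* R) (t : ℕ)

/-- The matrix of left multiplication by `r w ^ i` on `R[w, σ] / (w ^ t)`, with respect to the basis
`1, w, …, w ^ (t - 1)` of this right `R`-module. As `σ ^ t = 1`, one has
`r w ^ k = w ^ k σ ^ (t - k) (r)`. -/
def monomialMatrix (i : ℕ) (r : R) : Matrix (Fin t) (Fin t) R :=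
  Matrix.of fun k l => if (k : ℕ) = l + i then (σ ^ (t - (k : ℕ))) r else 0

theorem monomialMatrix_mul (i j : ℕ) (r s : R) :
    monomialMatrix σ t i r * monomialMatrix σ t j s =
      monomialMatrix σ t (i + j) (r * (σ ^ i) s) := by
  ext k l
  simp only [monomialMatrix, Matrix.mul_apply, Matrix.of_apply]
  by_cases hk : (k : ℕ) = l + (i + j)
  · have hlt : (l : ℕ) + j < t := by have := k.2; omega
    rw [Finset.sum_eq_single ⟨l + j, hlt⟩]
    · have hki : (k : ℕ) = l + j + i := by omega
      have hs : σ ^ (t - (l + j)) = σ ^ (t - (k : ℕ)) * σ ^ i := by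
        rw [← pow_add]
        congr 1
        have := k.2
        omega
      simp only [if_pos hki, if_pos hk, if_true, map_mul, hs]
      rfl
    · intro c _ hc
      have : (c : ℕ) ≠ l + j := fun h => hc (Fin.ext h)
      simp [this]
    · simp
  · rw [if_neg hk]
    refine Finset.sum_eq_zero fun c _ => ?_
    by_cases h1 : (k : ℕ) = c + i
    · have h2 : (c : ℕ) ≠ l + j := by omega
      simp [h2]
    · simp [h1]


theorem induction_add {motive : SkewPoly σ → Prop} (p : SkewPoly σ)
    (monomial : ∀ i r, motive (monomial σ i r))
    (add : ∀ p q, motive p → motive q → motive (p + q)) : motive p := by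
  refine SkewPolynomial.induction (R := R) (motive := motive) p ?_ ?_
  · have h := monomial 0 0
    have h0 : SkewPoly.monomial σ 0 0 = (0 : SkewPoly σ) := SkewPolynomial.monomial_zero_right 0
    rw [h0] at h
    exact h
  · intro n r q _ _ hq
    exact add _ _ (monomial n r) hq

/-- The additive map extending `r w ^ i ↦ monomialMatrix i r`. -/
noncomputable def toMatrixAddHom : SkewPoly σ →+ Matrix (Fin t) (Fin t) R where
  toFun p := SkewPolynomial.sum (R := R) p fun i r => monomialMatrix σ t i r
  map_zero' := SkewPolynomial.sum_zero_index _
  map_add' p q := by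
    refine SkewPolynomial.sum_add_index (R := R) p q _ ?_ ?_
    · intro i
      ext k l
      simp [monomialMatrix]
    · intro i a b
      ext k l
      simp only [monomialMatrix, Matrix.of_apply, Matrix.add_apply]
      split_ifs <;> simp

theorem toMatrixAddHom_monomial (i : ℕ) (r : R) :
    toMatrixAddHom σ t (monomial σ i r) = monomialMatrix σ t i r := by
  refine SkewPolynomial.sum_monomial_index (R := R) ?_
  ext k l
  simp [monomialMatrix]

/-- Left multiplication on `R[w, σ] / (w ^ t)` as a representation of `R[w, σ]` by matrices
over `R`. -/
noncomputable def toMatrix : SkewPoly σ →+* Matrix (Fin t) (Fin t) R where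
  __ := toMatrixAddHom σ t
  map_one' := by
    have h : (1 : SkewPoly σ) = monomial σ 0 1 := rfl
    change toMatrixAddHom σ t 1 = 1
    rw [h, toMatrixAddHom_monomial]
    ext k l
    simp [monomialMatrix, Matrix.one_apply, Fin.ext_iff]
  map_mul' p q := by
    change toMatrixAddHom σ t (p * q) = toMatrixAddHom σ t p * toMatrixAddHom σ t q
    induction p using induction_add σ with
    | add p p' hp hp' => rw [add_mul, map_add, map_add, hp, hp', add_mul]
    | monomial i r =>
      induction q using induction_add σ with
      | add q q' hq hq' => rw [mul_add, map_add, map_add, hq, hq', mul_add]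
      | monomial j s =>
        rw [monomial_mul_monomial, toMatrixAddHom_monomial, toMatrixAddHom_monomial,
          toMatrixAddHom_monomial, monomialMatrix_mul]

theorem toMatrix_monomial (i : ℕ) (r : R) :
    toMatrix σ t (monomial σ i r) = monomialMatrix σ t i r :=
  toMatrixAddHom_monomial σ t i r

theorem w_pow (i : ℕ) : w σ ^ i = monomial σ i 1 := by
  induction i with
  | zero => rfl
  | succ i ih => rw [pow_succ, ih, w, monomial_mul_monomial, map_one, mul_one]

/-- The first column of the matrix of `p` lists the images of the first `t` coefficients of `p`
under powers of `σ`. -/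
theorem toMatrix_apply_zero (ht : 0 < t) (p : SkewPoly σ) (i : Fin t) :
    toMatrix σ t p i ⟨0, ht⟩ = (σ ^ (t - (i : ℕ))) (SkewPolynomial.coeff (R := R) p i) := by
  induction p using induction_add σ with
  | add p q hp hq =>
    have h : SkewPolynomial.coeff (R := R) (p + q : SkewPoly σ) i =
        SkewPolynomial.coeff (R := R) p i + SkewPolynomial.coeff (R := R) q i :=
      SkewPolynomial.coeff_add (R := R) p q i
    rw [map_add, Matrix.add_apply, hp, hq, h, map_add]
  | monomial j r =>
    have h : SkewPolynomial.coeff (R := R) (monomial σ j r) i = if j = i then r else 0 :=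
      SkewPolynomial.coeff_monomial
    rw [toMatrix_monomial, h]
    simp only [monomialMatrix, Matrix.of_apply, zero_add, eq_comm (a := j)]
    split_ifs <;> simp

theorem mem_span_of_toMatrix_eq_zero (ht : 0 < t) (hσ : σ ^ t = 1) {p : SkewPoly σ}
    (hp : toMatrix σ t p = 0) : p ∈ TwoSidedIdeal.span {w σ ^ t} := by
  have hinj : Function.Injective σ := by
    obtain ⟨k, rfl⟩ := Nat.exists_eq_add_of_le' ht
    intro a b hab
    have h : ∀ c, (σ ^ k) (σ c) = c := fun c => by
      have := congrArg (fun f : R →+* R => f c) hσ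
      rwa [pow_succ] at this
    rw [← h a, ← h b, hab]
  have hcoeff : ∀ i < t, SkewPolynomial.coeff (R := R) p i = 0 := by
    intro i hi
    have h := toMatrix_apply_zero σ t ht p ⟨i, hi⟩
    rw [hp, Matrix.zero_apply, RingHom.coe_pow] at h
    exact hinj.iterate (t - i) (by rw [← h, ← RingHom.coe_pow, map_zero])
  have hsum : p = ∑ i ∈ SkewPolynomial.support (R := R) p,
      monomial σ i (SkewPolynomial.coeff (R := R) p i) :=
    ((SkewPolynomial.sum_def (R := R) p _).symm.trans (SkewPolynomial.sum_monomial p)).symm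
  rw [hsum]
  refine sum_mem fun i hi => ?_
  have hti : t ≤ i := by
    by_contra h
    exact SkewPolynomial.mem_support_iff.1 hi (hcoeff i (not_le.1 h))
  have : monomial σ i (SkewPolynomial.coeff (R := R) p i) =
      monomial σ (i - t) (SkewPolynomial.coeff (R := R) p i) * w σ ^ t := by
    rw [w_pow, monomial_mul_monomial, map_one, mul_one, Nat.sub_add_cancel hti]
  rw [this]
  exact TwoSidedIdeal.mul_mem_left _ _ _ (TwoSidedIdeal.subset_span rfl)

end SkewPoly

theorem TruncatedSkewPoly.exists_injective_ringHom {R : Type*} [Ring R] (σ : R →+* R) {t : ℕ}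
    (ht : 1 ≤ t) (hσ : σ ^ t = 1) :
    ∃ φ : TruncatedSkewPoly σ t →+* Matrix (Fin t) (Fin t) R, Function.Injective φ := by
  have hker : TwoSidedIdeal.span {SkewPoly.w σ ^ t} ≤
      TwoSidedIdeal.ker (SkewPoly.toMatrix σ t) := by
    rw [TwoSidedIdeal.span_le, Set.singleton_subset_iff, SetLike.mem_coe, TwoSidedIdeal.mem_ker,
      SkewPoly.w_pow, SkewPoly.toMatrix_monomial]
    ext k l
    have : (k : ℕ) ≠ l + t := by have := k.2; omega
    simp [SkewPoly.monomialMatrix, this]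
  have hle : (TwoSidedIdeal.span {SkewPoly.w σ ^ t}).ringCon ≤
      RingCon.ker (SkewPoly.toMatrix σ t) := by
    intro x y hxy
    have := hker ((TwoSidedIdeal.rel_iff _ x y).1 hxy)
    rw [TwoSidedIdeal.mem_ker, map_sub, sub_eq_zero] at this
    exact this
  refine ⟨RingCon.lift _ (SkewPoly.toMatrix σ t) hle, ?_⟩
  rw [injective_iff_map_eq_zero]
  intro a ha
  obtain ⟨p, rfl⟩ := RingCon.mk'_surjective _ a
  rw [← TwoSidedIdeal.mem_ker, TwoSidedIdeal.ker_ringCon_mk']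
  exact SkewPoly.mem_span_of_toMatrix_eq_zero σ t ht hσ ha

theorem mainTheorem5 {R : Type*} [Ring R] (σ : R →+* R) (t : ℕ) (ht : 1 ≤ t) (hσ : σ ^ t = 1)
    (m : ℕ) (hm : 1 ≤ m) (hR : SatisfiesStandardIdentity m R) :
    (∀ n : ℕ, 1 ≤ n →
      SatisfiesStandardIdentity ((m - 1) * t ^ 2 * n ^ 2 + 1)
        (Matrix (Fin n) (Fin n) (TruncatedSkewPoly σ t))) ∧
    SatisfiesStandardIdentity ((m - 1) * t ^ 2 + 1) (TruncatedSkewPoly σ t) := by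
  obtain ⟨φ, hφ⟩ := TruncatedSkewPoly.exists_injective_ringHom σ ht hσ
  refine ⟨fun n _ => ?_, ?_⟩
  · have h := hR.matrix (n := Fin n × Fin t) hm
    rw [Fintype.card_prod, Fintype.card_fin, Fintype.card_fin, mul_pow, mul_comm (n ^ 2),
      ← mul_assoc] at h
    refine h.of_injective ((Matrix.compRingEquiv (Fin n) (Fin t) R).toRingHom.comp φ.mapMatrix) ?_
    exact (Matrix.compRingEquiv (Fin n) (Fin t) R).injective.comp (Matrix.map_injective hφ)
  · have h := hR.matrix (n := Fin t) hm
    rw [Fintype.card_fin] at h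
    exact h.of_injective φ hφ
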